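/- Let $H$ be a complex Hilbert space and let $A,B$ be linear operators in $H$ with domains $D(A),D(B)$ such that 1. $A$, $B$ and, for every $u\in\mathbf R$, the operator $A+uB$ with domain $D(A)\cap D(B)$ are essentially skew-adjoint; 2. there are a Hilbert basis $(\phi_j)_{j\in\mathbf N}$ of $H$ and real numbers $\lambda_j$ with $\phi_j\in D(A)\cap D(B)$ and $A\phi_j=\mathrm i\lambda_j\phi_j$ for all $j$. Let $k>0$ and suppose that $(A,B)$ is $k$-weakly-coupled, that is, for a basis as in 2: $\lambda_j\to+\infty$ (or $\lambda_j\to-\infty$) as $j\to\infty$; $D(|A+uB|^{k/2})=D(|A|^{k/2})$ for every $u\in\mathbf R$; and there is a constant $c$ such that every $\psi\in D(|A|^k)$ lies in the domain of (the closure of) $B$ and satisfies $|\Re\langle |A|^k\psi,B\psi\rangle|\le c\,|\langle |A|^k\psi,\psi\rangle|$. Here and below, powers of absolute values and exponentials are those of the skew-adjoint closures. For a piecewise constant control $u:[0,t]\to\mathbf R$ taking successively the values $u_1,\dots,u_n$ during times $\tau_1,\dots,\tau_n\ge 0$ with $\tau_1+\dots+\tau_n=t$, put $\Upsilon^u_t=e^{\tau_n(A+u_nB)}\cdots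 e^{\tau_1(A+u_1B)}$. Let $\mathcal R_t(\psi_0)=\{\Upsilon^u_t\psi_0 : u \text{ piecewise constant on }[0,t]\}$ be the reachable set at time $t$, and $\mathcal R_{<T}(\psi_0)=\bigcup_{0\le t<T}\mathcal R_t(\psi_0)$ the reachable set at time smaller than $T$. Then, for every $\psi_0\in H$ with $\|\psi_0\|=1$ and every $T>0$, $$\{e^{KB}\psi_0 : K\in\mathbf R\}\subset\overline{\mathcal R_{<T}(\psi_0)}.$$ -/

import Mathlib

open scoped InnerProductSpace ENNReal

noncomputable section

namespace BilinearQuantum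

variable {H : Type*} [NormedAddCommGroup H] [InnerProductSpace ℂ H] [CompleteSpace H]

/-- A densely defined operator whose closure `S̄` is skew-adjoint: `S̄† = -S̄`. -/
structure IsEssentiallySkewAdjoint (S : H →ₗ.[ℂ] H) : Prop where
  dense : Dense (S.domain : Set H)
  closable : S.IsClosable
  adjoint_closure : S.closure.adjoint = -S.closure

/-- `U` is a strongly continuous one-parameter group of unitary operators whose infinitesimal
generator (with its exact domain) is `S`. -/
structure IsUnitaryGroupOf (S : H →ₗ.[ℂ] H) (U : ℝ → H ≃ₗᵢ[ℂ] H) : Prop where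
  map_add : ∀ s t : ℝ, U (s + t) = U s * U t
  continuous : ∀ ψ : H, Continuous fun t : ℝ => U t ψ
  generator : ∀ ψ v : H, (ψ, v) ∈ S.graph ↔ HasDerivAt (fun t : ℝ => U t ψ) v 0

open Classical in
/-- The unitary operator `e^{tS}`, where `S` denotes the closure of the given operator. It is the
member at time `t` of the unitary group generated by the closure; by Stone's theorem this group
exists, and is unique, for every essentially skew-adjoint operator. (Identity otherwise.) -/
def expGroup (S : H →ₗ.[ℂ] H) (t : ℝ) : H ≃ₗᵢ[ℂ] H :=
  if h : ∃ U : ℝ → H ≃ₗᵢ[ℂ] H, IsUnitaryGroupOf S.closure U then h.choose t else 1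

/-- The operator `A + uB`, with domain `D(A) ∩ D(B)`. -/
def controlled (A B : H →ₗ.[ℂ] H) (u : ℝ) : H →ₗ.[ℂ] H := A + (u : ℂ) • B

/-- The standing assumption on `(A, B)`, together with the Hilbert basis `φ` of eigenvectors of `A`
and the real numbers `lam k` such that `A φₖ = i lamₖ φₖ`. -/
structure StandingAssumption (A B : H →ₗ.[ℂ] H) (φ : HilbertBasis ℕ ℂ H) (lam : ℕ → ℝ) :
    Prop where
  skew_A : IsEssentiallySkewAdjoint A
  eigen : ∀ k, ∃ h : φ k ∈ A.domain, A ⟨φ k, h⟩ = (Complex.I * (lam k : ℂ)) • φ k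
  mem_B : ∀ k, φ k ∈ B.domain
  skew_controlled : ∀ u : ℝ, IsEssentiallySkewAdjoint (controlled A B u)
  skew_B : IsEssentiallySkewAdjoint B

/-- Domain of `|A|^s`, for `A` diagonal in the basis `φ` with eigenvalues `i lamⱼ`: the vectors `ψ`
with `∑ⱼ |lamⱼ|^{2s} |⟨φⱼ, ψ⟩|² < ∞`. -/
def diagAbsPowDomain (φ : HilbertBasis ℕ ℂ H) (lam : ℕ → ℝ) (s : ℝ) : Set H :=
  {ψ | Summable fun j => (|lam j| ^ s * ‖⟪φ j, ψ⟫_ℂ‖) ^ 2}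

/-- `|A|^s ψ = ∑ⱼ |lamⱼ|^s ⟨φⱼ, ψ⟩ φⱼ`, for `ψ` in the domain of `|A|^s`. -/
def diagAbsPow (φ : HilbertBasis ℕ ℂ H) (lam : ℕ → ℝ) (s : ℝ) (ψ : H) : H :=
  ∑' j, (((|lam j| ^ s : ℝ) : ℂ) * ⟪φ j, ψ⟫_ℂ) • φ j

/-- Domain of `|S|^s` for `S` (the closure of) an essentially skew-adjoint operator, by the
functional calculus: the vectors `ψ` with `∫ |x|^{2s} dμ_ψ(x) < ∞`, where the spectral measure
`μ_ψ` of `-iS` at `ψ` is the finite measure with `∫ e^{itx} dμ_ψ(x) = ⟨ψ, e^{tS} ψ⟩` for all `t`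
(there is exactly one). -/
def absPowDomain (S : H →ₗ.[ℂ] H) (s : ℝ) : Set H :=
  {ψ | ∃ μ : MeasureTheory.Measure ℝ, MeasureTheory.IsFiniteMeasure μ ∧
    (∀ t : ℝ, MeasureTheory.charFun μ t = ⟪ψ, expGroup S t ψ⟫_ℂ) ∧
    ∫⁻ x, ENNReal.ofReal (|x| ^ (2 * s)) ∂μ < ∞}

/-- `(A, B)` is `k`-weakly-coupled. In the coupling inequality, `B` stands for the skew-adjoint
closure of `B`, so that `D(|A|^k)` is only required to lie in the domain of the closure. -/
def IsWeaklyCoupled (k : ℝ) (A B : H →ₗ.[ℂ] H) : Prop :=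
  ∃ (φ : HilbertBasis ℕ ℂ H) (lam : ℕ → ℝ),
    StandingAssumption A B φ lam ∧
    (Filter.Tendsto lam Filter.atTop Filter.atTop ∨
      Filter.Tendsto lam Filter.atTop Filter.atBot) ∧
    (∀ u : ℝ, absPowDomain (controlled A B u) (k / 2) = diagAbsPowDomain φ lam (k / 2)) ∧
    ∃ c : ℝ, ∀ ψ ∈ diagAbsPowDomain φ lam k, ∃ hB : ψ ∈ B.closure.domain,
      |(⟪diagAbsPow φ lam k ψ, B.closure ⟨ψ, hB⟩⟫_ℂ).re| ≤ c * ‖⟪diagAbsPow φ lam k ψ, ψ⟫_ℂ‖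

/-- The solution at the final time, from initial state `ψ`, of `ψ' = (A + u(t)B)ψ` for the piecewise
constant control that takes successively the values `u` during the times `τ`, for `(u, τ)` in the
list. -/
def solution (A B : H →ₗ.[ℂ] H) : List (ℝ × ℝ) → H → H
  | [], ψ => ψ
  | (u, τ) :: w, ψ => solution A B w (expGroup (controlled A B u) τ ψ)

/-- The reachable set from `ψ` at time `T`, with piecewise constant controls. -/
def reachableSet (A B : H →ₗ.[ℂ] H) (T : ℝ) (ψ : H) : Set H :=
  {ψ' | ∃ w : List (ℝ × ℝ), (∀ p ∈ w, 0 ≤ p.2) ∧ (w.map Prod.snd).sum = T ∧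
    solution A B w ψ = ψ'}

/-- The reachable set from `ψ` at time smaller than `T`. -/
def reachableSetLT (A B : H →ₗ.[ℂ] H) (T : ℝ) (ψ : H) : Set H :=
  {ψ' | ∃ t : ℝ, 0 ≤ t ∧ t < T ∧ ψ' ∈ reachableSet A B t ψ}

end BilinearQuantum

end

noncomputable section

set_option linter.unusedSectionVars false

open Filter Topology

namespace BilinearQuantum

variable {H : Type*} [NormedAddCommGroup H] [InnerProductSpace ℂ H] [CompleteSpace H]

/-! Apply the constant control K/τ during time τ: the propagator is the exponential of τA + KB, and
as τ → 0+ it should tend strongly to e^{KB}. On a vector of D(A) ∩ D(B) the exponents converge, so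
everything rests on having enough such vectors, namely a core of the closure of B.

That core is the span of the eigenvectors of A. `IsSkewAdjoint.exists_mem_span_of_commutator_bound`
derives it from the coupling inequality by a Nelson-type argument. `tendsto_of_core` then turns
convergence on a core into strong convergence of the groups. It replaces an orbit of e^{KB} by a
polygon with vertices in the core and compares the propagator with this polygon step by step
(`IsUnitaryGroupOf.norm_apply_sub_le`).

Since exponentials are defined through their generators, Stone's existence theorem is needed as
well; it is proved by bounded, commuting, skew-adjoint approximations (`IsSkewAdjoint.yosida`). -/

/-- A densely defined operator `G` with `G† = -G`, expressed through its graph. -/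
structure IsSkewAdjoint (G : H →ₗ.[ℂ] H) : Prop where
  dense : Dense (G.domain : Set H)
  isClosed : G.IsClosed
  mem_graph_iff : ∀ x y : H, (x, y) ∈ G.graph ↔
    ∀ a b : H, (a, b) ∈ G.graph → ⟪b, x⟫_ℂ + ⟪a, y⟫_ℂ = 0

theorem IsEssentiallySkewAdjoint.isSkewAdjoint_closure {S : H →ₗ.[ℂ] H}
    (hS : IsEssentiallySkewAdjoint S) : IsSkewAdjoint S.closure where
  dense := hS.dense.mono S.le_closure.1
  isClosed := hS.closable.closure_isClosed
  mem_graph_iff x y := by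
    have hd : Dense (S.closure.domain : Set H) := hS.dense.mono S.le_closure.1
    have h := LinearPMap.adjoint_graph_eq_graph_adjoint hd
    rw [hS.adjoint_closure, LinearPMap.neg_graph] at h
    have h1 : (x, y) ∈ S.closure.graph ↔ (x, -y) ∈ S.closure.graph.map
        ((LinearMap.id : H →ₗ[ℂ] H).prodMap (-(LinearMap.id : H →ₗ[ℂ] H))) := by
      simp only [Submodule.mem_map, LinearMap.prodMap_apply, LinearMap.id_coe, id,
        LinearMap.neg_apply, Prod.mk.injEq, Prod.exists, neg_inj]
      exact ⟨fun h => ⟨x, y, h, rfl, rfl⟩, by rintro ⟨a, b, h, rfl, rfl⟩; exact h⟩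
    rw [h1, h, Submodule.mem_adjoint_iff]
    simp only [inner_neg_right, sub_neg_eq_add]

/-! ### Resolvents of skew-adjoint operators -/

namespace IsSkewAdjoint

variable {G : H →ₗ.[ℂ] H} (hG : IsSkewAdjoint G)

include hG

theorem inner_add_inner {x y a b : H} (h : (x, y) ∈ G.graph) (h' : (a, b) ∈ G.graph) :
    ⟪b, x⟫_ℂ + ⟪a, y⟫_ℂ = 0 :=
  (hG.mem_graph_iff x y).1 h a b h'

theorem re_inner_eq_zero {x y : H} (h : (x, y) ∈ G.graph) : (⟪x, y⟫_ℂ).re = 0 := by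
  have h1 := congrArg Complex.re (hG.inner_add_inner h h)
  have h2 : (⟪y, x⟫_ℂ).re = (⟪x, y⟫_ℂ).re := inner_re_symm (𝕜 := ℂ) y x
  simp only [Complex.add_re, Complex.zero_re] at h1
  linarith

theorem norm_sq_smul_sub {x y : H} (h : (x, y) ∈ G.graph) (n : ℝ) :
    ‖(n : ℂ) • x - y‖ ^ 2 = n ^ 2 * ‖x‖ ^ 2 + ‖y‖ ^ 2 := by
  have h0 := hG.re_inner_eq_zero h
  rw [norm_sub_sq (𝕜 := ℂ), inner_smul_left, norm_smul, mul_pow]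
  simp [h0]

theorem norm_le_of_mem_graph {x y : H} (h : (x, y) ∈ G.graph) (n : ℝ) :
    ‖y‖ ≤ ‖(n : ℂ) • x - y‖ := by
  have := hG.norm_sq_smul_sub h n
  refine le_of_sq_le_sq ?_ (norm_nonneg _)
  nlinarith [mul_nonneg (sq_nonneg n) (sq_nonneg ‖x‖)]

theorem abs_mul_norm_le_of_mem_graph {x y : H} (h : (x, y) ∈ G.graph) (n : ℝ) :
    |n| * ‖x‖ ≤ ‖(n : ℂ) • x - y‖ := by
  have := hG.norm_sq_smul_sub h n
  refine le_of_sq_le_sq ?_ (norm_nonneg _)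
  rw [mul_pow, sq_abs]
  nlinarith [sq_nonneg ‖y‖]

/-- The map n - G is bounded below on its closed graph, so its range is closed; it remains to see
that the orthogonal complement of the range is trivial. -/
theorem exists_smul_sub_eq {n : ℝ} (hn : n ≠ 0) (f : H) :
    ∃ x y : H, (x, y) ∈ G.graph ∧ (n : ℂ) • x - y = f := by
  let L : G.graph →L[ℂ] H :=
    ((n : ℂ) • ContinuousLinearMap.fst ℂ H H - ContinuousLinearMap.snd ℂ H H).comp
      G.graph.subtypeL
  have hL : ∀ p : G.graph, L p = (n : ℂ) • p.1.1 - p.1.2 := fun p => rfl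
  have hbd : ∀ p : G.graph, ‖p‖ ≤ (max 1 |n|⁻¹) * ‖L p‖ := by
    intro p
    rw [hL]
    have hp : (p.1.1, p.1.2) ∈ G.graph := p.2
    have h1 := hG.norm_le_of_mem_graph hp n
    have h2 := hG.abs_mul_norm_le_of_mem_graph hp n
    have hn' : 0 < |n| := abs_pos.2 hn
    refine (Prod.norm_def p.1).le.trans (max_le ?_ ?_)
    · have : ‖p.1.1‖ ≤ |n|⁻¹ * ‖(n : ℂ) • p.1.1 - p.1.2‖ := by
        rw [inv_mul_eq_div, le_div_iff₀ hn']; linarith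
      exact this.trans (by gcongr; exact le_max_right _ _)
    · exact h1.trans (le_mul_of_one_le_left (norm_nonneg _) (le_max_left _ _))
  have hcl : IsClosed (Set.range L) := by
    have : CompleteSpace G.graph := (show IsClosed (G.graph : Set (H × H)) from
      hG.isClosed).completeSpace_coe
    have hanti : AntilipschitzWith (max 1 |n|⁻¹).toNNReal L :=
      L.antilipschitz_of_bound (fun p => by
        rw [Real.coe_toNNReal _ (by positivity)]; exact hbd p)
    exact hanti.isClosed_range L.uniformContinuous
  let M : Submodule ℂ H := LinearMap.range L.toLinearMap
  have : CompleteSpace M := (show IsClosed (M : Set H) from by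
    convert hcl using 1; ext; simp [M]).completeSpace_coe
  have hbot : Mᗮ = ⊥ := by
    rw [Submodule.eq_bot_iff]
    intro z hz
    -- Orthogonality to the range puts z in the domain of the adjoint, hence of G, as an eigenvector
    -- with real eigenvalue -n; as Re⟨z, Gz⟩ = 0, it vanishes.
    have hz1 : (z, ((-n : ℝ) : ℂ) • z) ∈ G.graph := by
      rw [hG.mem_graph_iff]
      intro a b hab
      have := (Submodule.mem_orthogonal M z).1 hz _ ⟨⟨(a, b), hab⟩, rfl⟩
      change ⟪(n : ℂ) • a - b, z⟫_ℂ = 0 at this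
      rw [inner_sub_left, inner_smul_left] at this
      rw [inner_smul_right]
      simp only [Complex.conj_ofReal] at this
      push_cast
      linear_combination -this
    have h0 := hG.re_inner_eq_zero hz1
    rw [inner_smul_right, Complex.re_ofReal_mul] at h0
    have h1 : (⟪z, z⟫_ℂ).re = 0 := (mul_eq_zero.1 h0).resolve_left (neg_ne_zero.2 hn)
    exact (inner_self_eq_zero (𝕜 := ℂ)).1 (Complex.ext h1 (inner_self_im (𝕜 := ℂ) z))
  have htop : M = ⊤ := (Submodule.orthogonal_eq_bot_iff).1 hbot
  obtain ⟨p, hp⟩ : f ∈ M := htop ▸ Submodule.mem_top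
  exact ⟨p.1.1, p.1.2, p.2, hp⟩

theorem exists_resolvent {n : ℝ} (hn : n ≠ 0) (f : H) :
    ∃ x : H, (x, (n : ℂ) • (x - f)) ∈ G.graph := by
  obtain ⟨x, y, hxy, h⟩ := hG.exists_smul_sub_eq hn ((n : ℂ) • f)
  refine ⟨x, ?_⟩
  rw [smul_sub, ← h, sub_sub_cancel]
  exact hxy

omit hG in
theorem smul_mem_graph {x y : H} (c : ℂ) (h : (x, y) ∈ G.graph) : (c • x, c • y) ∈ G.graph :=
  G.graph.smul_mem c h

omit hG in
theorem sub_mem_graph {x y a b : H} (h : (x, y) ∈ G.graph) (h' : (a, b) ∈ G.graph) :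
    (x - a, y - b) ∈ G.graph :=
  G.graph.sub_mem h h'

theorem resolvent_unique {n : ℝ} (hn : n ≠ 0) {f x x' : H}
    (h : (x, (n : ℂ) • (x - f)) ∈ G.graph) (h' : (x', (n : ℂ) • (x' - f)) ∈ G.graph) :
    x = x' := by
  have h1 := hG.abs_mul_norm_le_of_mem_graph (sub_mem_graph h h') n
  have h2 : (n : ℂ) • (x - x') - ((n : ℂ) • (x - f) - (n : ℂ) • (x' - f)) = 0 := by module
  rw [h2, norm_zero] at h1
  have h3 : ‖x - x'‖ ≤ 0 := by
    by_contra! h3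
    have := mul_pos (abs_pos.2 hn) h3
    linarith
  exact sub_eq_zero.1 (norm_le_zero_iff.1 h3)

/-- The operator `n (n - G)⁻¹` for real `n ≠ 0`. -/
def resolvent (n : ℝ) (hn : n ≠ 0) : H →L[ℂ] H :=
  LinearMap.mkContinuous
    { toFun := fun f => (hG.exists_resolvent hn f).choose
      map_add' := fun f g => hG.resolvent_unique hn (hG.exists_resolvent hn (f + g)).choose_spec (by
        have := G.graph.add_mem (hG.exists_resolvent hn f).choose_spec
          (hG.exists_resolvent hn g).choose_spec
        convert this using 1
        simp only [Prod.mk_add_mk, Prod.mk.injEq, true_and]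
        module)
      map_smul' := fun c f => hG.resolvent_unique hn
        (hG.exists_resolvent hn (c • f)).choose_spec (by
        have := G.graph.smul_mem c (hG.exists_resolvent hn f).choose_spec
        convert this using 1
        simp only [RingHom.id_apply, Prod.smul_mk, Prod.mk.injEq, true_and]
        module) } 1 (fun f => by
      have h := hG.abs_mul_norm_le_of_mem_graph (hG.exists_resolvent hn f).choose_spec n
      have h2 : ∀ x : H, (n : ℂ) • x - (n : ℂ) • (x - f) = (n : ℂ) • f := fun x => by module
      rw [h2, norm_smul, Complex.norm_real, Real.norm_eq_abs] at h
      simpa using le_of_mul_le_mul_left h (abs_pos.2 hn))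

variable {n m : ℝ} (hn : n ≠ 0) (hm : m ≠ 0)

theorem resolvent_mem_graph (f : H) :
    (hG.resolvent n hn f, (n : ℂ) • (hG.resolvent n hn f - f)) ∈ G.graph :=
  (hG.exists_resolvent hn f).choose_spec

theorem eq_resolvent {f x : H} (h : (x, (n : ℂ) • (x - f)) ∈ G.graph) :
    x = hG.resolvent n hn f :=
  hG.resolvent_unique hn h (hG.resolvent_mem_graph hn f)

theorem norm_resolvent_le (f : H) : ‖hG.resolvent n hn f‖ ≤ ‖f‖ := by
  have h := hG.abs_mul_norm_le_of_mem_graph (hG.resolvent_mem_graph hn f) n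
  have h2 : ∀ x : H, (n : ℂ) • x - (n : ℂ) • (x - f) = (n : ℂ) • f := fun x => by module
  rw [h2, norm_smul, Complex.norm_real, Real.norm_eq_abs] at h
  exact le_of_mul_le_mul_left h (abs_pos.2 hn)

/-- The resolvent commutes with `G`. -/
theorem resolvent_apply_of_mem_graph {a b : H} (h : (a, b) ∈ G.graph) :
    hG.resolvent n hn b = (n : ℂ) • (hG.resolvent n hn a - a) := by
  refine (hG.eq_resolvent hn ?_).symm
  have h1 := smul_mem_graph (n : ℂ) (sub_mem_graph (hG.resolvent_mem_graph hn a) h)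
  exact h1

theorem resolvent_map_mem_graph {a b : H} (h : (a, b) ∈ G.graph) :
    (hG.resolvent n hn a, hG.resolvent n hn b) ∈ G.graph := by
  rw [hG.resolvent_apply_of_mem_graph hn h]
  exact hG.resolvent_mem_graph hn a

theorem resolvent_comm (f : H) :
    hG.resolvent n hn (hG.resolvent m hm f) = hG.resolvent m hm (hG.resolvent n hn f) := by
  refine hG.eq_resolvent hm ?_
  have := hG.resolvent_map_mem_graph hn (hG.resolvent_mem_graph hm f)
  rwa [map_smul, map_sub] at this

/-- Taking adjoints flips the sign of n; this is why a difference of the resolvents at n and -n is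
skew-adjoint. -/
theorem inner_resolvent_left (f g : H) :
    ⟪hG.resolvent n hn f, g⟫_ℂ = ⟪f, hG.resolvent (-n) (neg_ne_zero.2 hn) g⟫_ℂ := by
  have h := hG.inner_add_inner (hG.resolvent_mem_graph (neg_ne_zero.2 hn) g)
    (hG.resolvent_mem_graph hn f)
  simp only [inner_smul_left, inner_smul_right, inner_sub_left, inner_sub_right,
    Complex.conj_ofReal, Complex.ofReal_neg] at h
  have hn' : (n : ℂ) ≠ 0 := Complex.ofReal_ne_zero.2 hn
  refine mul_left_cancel₀ hn' ?_
  linear_combination h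

theorem norm_resolvent_sub_le {a b : H} (h : (a, b) ∈ G.graph) :
    ‖hG.resolvent n hn a - a‖ ≤ |n|⁻¹ * ‖b‖ := by
  have h1 := hG.norm_resolvent_le hn b
  rw [hG.resolvent_apply_of_mem_graph hn h, norm_smul, Complex.norm_real, Real.norm_eq_abs] at h1
  rwa [inv_mul_eq_div, le_div_iff₀ (abs_pos.2 hn), mul_comm]

end IsSkewAdjoint

/-! ### Exponentials of bounded skew-adjoint operators -/

section BoundedSkewAdjoint

variable {D D' : H →L[ℂ] H}

theorem mem_skewAdjoint_of_inner (h : ∀ x y, ⟪D x, y⟫_ℂ = -⟪x, D y⟫_ℂ) :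
    D ∈ skewAdjoint (H →L[ℂ] H) := by
  rw [skewAdjoint.mem_iff, ContinuousLinearMap.star_eq_adjoint, eq_comm,
    ContinuousLinearMap.eq_adjoint_iff]
  intro x y
  simp [h]

theorem smul_mem_skewAdjoint (hD : D ∈ skewAdjoint (H →L[ℂ] H)) (t : ℝ) :
    t • D ∈ skewAdjoint (H →L[ℂ] H) := by
  rw [skewAdjoint.mem_iff] at *
  rw [star_smul, hD, star_trivial, smul_neg]

theorem norm_exp_apply (hD : D ∈ skewAdjoint (H →L[ℂ] H)) (t : ℝ) (ψ : H) :
    ‖NormedSpace.exp (t • D) ψ‖ = ‖ψ‖ := by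
  let +nondep : NormedAlgebra ℚ (H →L[ℂ] H) := .restrictScalars ℚ ℂ _
  have h := NormedSpace.exp_mem_unitary_of_mem_skewAdjoint (smul_mem_skewAdjoint hD t)
  exact (ContinuousLinearMap.inner_map_map_iff_adjoint_comp_self _ |>.2 (Unitary.mem_iff.1 h).1 |>
    fun h => by
      have := h ψ ψ
      rw [inner_self_eq_norm_sq_to_K, inner_self_eq_norm_sq_to_K] at this
      exact (sq_eq_sq₀ (norm_nonneg _) (norm_nonneg _)).1 (by exact_mod_cast this))

theorem hasDerivAt_exp_smul_apply (D : H →L[ℂ] H) (ψ : H) (t : ℝ) :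
    HasDerivAt (fun s : ℝ => NormedSpace.exp (s • D) ψ) (NormedSpace.exp (t • D) (D ψ)) t :=
  ((ContinuousLinearMap.apply ℂ H ψ).restrictScalars ℝ).hasFDerivAt.comp_hasDerivAt t
    (hasDerivAt_exp_smul_const D t)

theorem norm_exp_smul_sub_self_le (hD : D ∈ skewAdjoint (H →L[ℂ] H)) (t : ℝ) (ψ : H) :
    ‖NormedSpace.exp (t • D) ψ - ψ‖ ≤ |t| * ‖D ψ‖ := by
  have := convex_univ.norm_image_sub_le_of_norm_hasDerivWithin_le
    (fun s _ => (hasDerivAt_exp_smul_apply D ψ s).hasDerivWithinAt)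
    (fun s _ => (norm_exp_apply hD s _).le) (Set.mem_univ (0 : ℝ)) (Set.mem_univ t)
  simpa [mul_comm] using this

/-- The derivative of the remainder is e^{sD}Dψ - Dψ. The vector z stands in for Dψ: for
approximations D of an unbounded G, D applied to Dψ need not stay bounded, whereas Dz does once z is
in the domain of G. -/
theorem norm_exp_smul_sub_self_sub_le (hD : D ∈ skewAdjoint (H →L[ℂ] H)) (t : ℝ) (ψ z : H) :
    ‖NormedSpace.exp (t • D) ψ - ψ - t • D ψ‖ ≤ |t| * (2 * ‖D ψ - z‖ + |t| * ‖D z‖) := by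
  have hd : ∀ s : ℝ, HasDerivAt (fun s : ℝ => NormedSpace.exp (s • D) ψ - ψ - s • D ψ)
      (NormedSpace.exp (s • D) (D ψ) - D ψ) s := fun s => by
    have h := ((hasDerivAt_exp_smul_apply D ψ s).sub_const ψ).sub
      ((hasDerivAt_id s).smul_const (D ψ))
    rw [one_smul] at h
    exact h
  have hb : ∀ s ∈ Set.Icc (-|t|) |t|, ‖NormedSpace.exp (s • D) (D ψ) - D ψ‖ ≤
      2 * ‖D ψ - z‖ + |t| * ‖D z‖ := fun s hs => by
    have h1 : NormedSpace.exp (s • D) (D ψ) - D ψ = NormedSpace.exp (s • D) (D ψ - z) +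
        (NormedSpace.exp (s • D) z - z) - (D ψ - z) := by
      rw [map_sub]; abel
    have h2 := norm_exp_smul_sub_self_le hD s z
    have h3 : |s| * ‖D z‖ ≤ |t| * ‖D z‖ :=
      mul_le_mul_of_nonneg_right (abs_le.2 hs) (norm_nonneg _)
    rw [h1]
    refine (norm_sub_le _ _).trans ((add_le_add_left (norm_add_le _ _) _).trans ?_)
    rw [norm_exp_apply hD]
    linarith
  have := (convex_Icc (-|t|) |t|).norm_image_sub_le_of_norm_hasDerivWithin_le
    (fun s _ => (hd s).hasDerivWithinAt) hb (x := 0) (y := t) (by simp)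
    ⟨neg_abs_le t, le_abs_self t⟩
  simpa [mul_comm] using this

/-- Commutation gives e^{tD} = e^{tD'} e^{t(D - D')}, and the first factor is isometric. -/
theorem norm_exp_smul_sub_exp_smul_le (hD : D ∈ skewAdjoint (H →L[ℂ] H))
    (hD' : D' ∈ skewAdjoint (H →L[ℂ] H)) (hc : Commute D D') (t : ℝ) (ψ : H) :
    ‖NormedSpace.exp (t • D) ψ - NormedSpace.exp (t • D') ψ‖ ≤ |t| * ‖D ψ - D' ψ‖ := by
  let +nondep : NormedAlgebra ℚ (H →L[ℂ] H) := .restrictScalars ℚ ℂ _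
  have h1 : t • D = t • D' + t • (D - D') := by module
  have h2 : Commute (t • D') (t • (D - D')) :=
    ((hc.symm.sub_right (Commute.refl D')).smul_left t).smul_right t
  rw [h1, NormedSpace.exp_add_of_commute h2, ContinuousLinearMap.mul_def,
    ContinuousLinearMap.comp_apply, ← map_sub, norm_exp_apply hD']
  exact norm_exp_smul_sub_self_le (sub_mem hD hD') t ψ

theorem exp_add_smul_apply (D : H →L[ℂ] H) (s t : ℝ) (ψ : H) :
    NormedSpace.exp ((s + t) • D) ψ = NormedSpace.exp (s • D) (NormedSpace.exp (t • D) ψ) := by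
  let +nondep : NormedAlgebra ℚ (H →L[ℂ] H) := .restrictScalars ℚ ℂ _
  rw [add_smul, NormedSpace.exp_add_of_commute (((Commute.refl D).smul_left s).smul_right t),
    ContinuousLinearMap.mul_def, ContinuousLinearMap.comp_apply]

end BoundedSkewAdjoint

/-! ### Yosida approximation and Stone's theorem -/

namespace IsSkewAdjoint

variable {G : H →ₗ.[ℂ] H} (hG : IsSkewAdjoint G)

include hG

theorem exists_norm_resolvent_sub_lt (f : H) {ε : ℝ} (hε : 0 < ε) :
    ∃ N : ℝ, ∀ (n : ℝ) (hn : n ≠ 0), N < |n| → ‖hG.resolvent n hn f - f‖ < ε := by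
  obtain ⟨a, ha, haf⟩ := Metric.mem_closure_iff.1 (hG.dense f) (ε / 4) (by positivity)
  obtain ⟨b, hab⟩ := LinearPMap.mem_domain_iff.1 ha
  refine ⟨‖b‖ / (ε / 4), fun n hn hN => ?_⟩
  have h1 := hG.norm_resolvent_sub_le hn hab
  have h2 : |n|⁻¹ * ‖b‖ < ε / 4 := by
    rw [inv_mul_eq_div, div_lt_iff₀ (abs_pos.2 hn)]
    rw [div_lt_iff₀ (by positivity)] at hN
    linarith
  have h3 : hG.resolvent n hn f - f =
      hG.resolvent n hn (f - a) + (hG.resolvent n hn a - a) - (f - a) := by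
    rw [map_sub]; abel
  have h4 := hG.norm_resolvent_le hn (f - a)
  rw [dist_eq_norm] at haf
  rw [h3]
  have h5 := norm_sub_le (hG.resolvent n hn (f - a) + (hG.resolvent n hn a - a)) (f - a)
  have h6 := norm_add_le (hG.resolvent n hn (f - a)) (hG.resolvent n hn a - a)
  linarith

/-- Bounded skew-adjoint approximations of a skew-adjoint operator. -/
def yosida (k : ℕ) : H →L[ℂ] H :=
  (((k + 1 : ℝ) / 2 : ℝ) : ℂ) • (hG.resolvent (k + 1) (by positivity) -
    hG.resolvent (-(k + 1)) (neg_ne_zero.2 (by positivity)))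

theorem yosida_mem_skewAdjoint (k : ℕ) : hG.yosida k ∈ skewAdjoint (H →L[ℂ] H) := by
  refine mem_skewAdjoint_of_inner fun f g => ?_
  have hk : (k + 1 : ℝ) ≠ 0 := by positivity
  have h1 := hG.inner_resolvent_left hk f g
  have h2 := congrArg (starRingEnd ℂ) (hG.inner_resolvent_left hk g f)
  simp only [inner_conj_symm] at h2
  simp only [yosida, smul_apply, sub_apply,
    inner_smul_left, inner_smul_right, inner_sub_left, inner_sub_right, h1, ← h2,
    Complex.conj_ofReal]
  ring

theorem yosida_commute (k l : ℕ) : Commute (hG.yosida k) (hG.yosida l) := by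
  have h : ∀ {n m : ℝ} (hn : n ≠ 0) (hm : m ≠ 0),
      Commute (hG.resolvent n hn) (hG.resolvent m hm) := fun hn hm =>
    ContinuousLinearMap.ext fun f => hG.resolvent_comm hn hm f
  refine Commute.smul_left (Commute.smul_right ?_ _) _
  exact ((h _ _).sub_right (h _ _)).sub_left ((h _ _).sub_right (h _ _))

/-- With Rₙ the resolvent operator, n(Rₙa - a) = Rₙb holds at both n and -n. In the difference the
terms in a cancel and the growing factor n disappears. -/
theorem yosida_apply {a b : H} (hab : (a, b) ∈ G.graph) (k : ℕ) :
    hG.yosida k a = (1 / 2 : ℂ) • (hG.resolvent (k + 1) (by positivity) b +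
      hG.resolvent (-(k + 1)) (neg_ne_zero.2 (by positivity)) b) := by
  rw [hG.resolvent_apply_of_mem_graph _ hab, hG.resolvent_apply_of_mem_graph _ hab, yosida,
    smul_apply, sub_apply]
  push_cast
  module

theorem tendsto_yosida {a b : H} (hab : (a, b) ∈ G.graph) :
    Tendsto (fun k => hG.yosida k a) atTop (𝓝 b) := by
  rw [Metric.tendsto_atTop]
  intro ε hε
  obtain ⟨N, hN⟩ := hG.exists_norm_resolvent_sub_lt b hε
  obtain ⟨M, hM⟩ := exists_nat_ge N
  refine ⟨M, fun k hk => ?_⟩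
  have hk' : (M : ℝ) ≤ k := by exact_mod_cast hk
  have hpos : (0 : ℝ) < k + 1 := by positivity
  have h1 := hN (k + 1) hpos.ne' (by rw [abs_of_pos hpos]; linarith)
  have h2 := hN (-(k + 1)) (neg_ne_zero.2 hpos.ne') (by rw [abs_neg, abs_of_pos hpos]; linarith)
  have h3 : hG.yosida k a - b = (1 / 2 : ℂ) • ((hG.resolvent (k + 1) hpos.ne' b - b) +
      (hG.resolvent (-(k + 1)) (neg_ne_zero.2 hpos.ne') b - b)) := by
    rw [hG.yosida_apply hab]; module
  rw [dist_eq_norm, h3, norm_smul]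
  have h4 := norm_add_le (hG.resolvent (k + 1) hpos.ne' b - b)
      (hG.resolvent (-(k + 1)) (neg_ne_zero.2 hpos.ne') b - b)
  have h5 : ‖(1 / 2 : ℂ)‖ = 1 / 2 := by norm_num
  rw [h5]
  linarith

theorem cauchySeq_exp_yosida (t : ℝ) (ψ : H) :
    CauchySeq fun k => NormedSpace.exp (t • hG.yosida k) ψ := by
  rw [Metric.cauchySeq_iff']
  intro ε hε
  obtain ⟨a, ha, haf⟩ := Metric.mem_closure_iff.1 (hG.dense ψ) (ε / 4) (by positivity)
  obtain ⟨b, hab⟩ := LinearPMap.mem_domain_iff.1 ha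
  obtain ⟨N, hN⟩ := Metric.cauchySeq_iff'.1
    ((hG.tendsto_yosida hab).const_smul t).cauchySeq (ε / 4) (by positivity)
  refine ⟨N, fun k hk => ?_⟩
  have h1 := hN k hk
  have h2 := norm_exp_smul_sub_exp_smul_le (hG.yosida_mem_skewAdjoint k)
    (hG.yosida_mem_skewAdjoint N) (hG.yosida_commute k N) t a
  rw [dist_eq_norm, ← smul_sub, norm_smul, Real.norm_eq_abs] at h1
  have h3 : NormedSpace.exp (t • hG.yosida k) ψ - NormedSpace.exp (t • hG.yosida N) ψ =
      NormedSpace.exp (t • hG.yosida k) (ψ - a) +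
      (NormedSpace.exp (t • hG.yosida k) a - NormedSpace.exp (t • hG.yosida N) a) -
      NormedSpace.exp (t • hG.yosida N) (ψ - a) := by
    rw [map_sub, map_sub]; abel
  have h4 := norm_sub_le (NormedSpace.exp (t • hG.yosida k) (ψ - a) +
      (NormedSpace.exp (t • hG.yosida k) a - NormedSpace.exp (t • hG.yosida N) a))
      (NormedSpace.exp (t • hG.yosida N) (ψ - a))
  have h5 := norm_add_le (NormedSpace.exp (t • hG.yosida k) (ψ - a))
      (NormedSpace.exp (t • hG.yosida k) a - NormedSpace.exp (t • hG.yosida N) a)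
  rw [norm_exp_apply (hG.yosida_mem_skewAdjoint _)] at h4 h5
  rw [dist_eq_norm] at haf ⊢
  rw [h3]
  linarith

/-- The unitary group generated by `G`, as a strong limit of exponentials. -/
def groupFun (t : ℝ) (ψ : H) : H :=
  (cauchySeq_tendsto_of_complete (hG.cauchySeq_exp_yosida t ψ)).choose

theorem tendsto_groupFun (t : ℝ) (ψ : H) :
    Tendsto (fun k => NormedSpace.exp (t • hG.yosida k) ψ) atTop (𝓝 (hG.groupFun t ψ)) :=
  (cauchySeq_tendsto_of_complete (hG.cauchySeq_exp_yosida t ψ)).choose_spec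

theorem groupFun_add (s t : ℝ) (ψ : H) :
    hG.groupFun (s + t) ψ = hG.groupFun s (hG.groupFun t ψ) := by
  refine tendsto_nhds_unique (hG.tendsto_groupFun (s + t) ψ) ?_
  refine ((hG.tendsto_groupFun s (hG.groupFun t ψ))).congr_dist ?_
  have h := tendsto_iff_dist_tendsto_zero.1 (hG.tendsto_groupFun t ψ)
  refine h.congr fun k => ?_
  rw [exp_add_smul_apply, dist_comm, dist_eq_norm, dist_eq_norm, ← map_sub,
    norm_exp_apply (hG.yosida_mem_skewAdjoint _)]

theorem groupFun_zero (ψ : H) : hG.groupFun 0 ψ = ψ := by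
  refine tendsto_nhds_unique (hG.tendsto_groupFun 0 ψ) ?_
  simp

theorem norm_groupFun (t : ℝ) (ψ : H) : ‖hG.groupFun t ψ‖ = ‖ψ‖ := by
  refine tendsto_nhds_unique (hG.tendsto_groupFun t ψ).norm ?_
  simp only [norm_exp_apply (hG.yosida_mem_skewAdjoint _), tendsto_const_nhds]

/-- The unitary group generated by `G`. -/
def unitaryGroup (t : ℝ) : H ≃ₗᵢ[ℂ] H where
  toFun := hG.groupFun t
  invFun := hG.groupFun (-t)
  map_add' x y := tendsto_nhds_unique (hG.tendsto_groupFun t (x + y)) (by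
    simpa only [map_add] using (hG.tendsto_groupFun t x).add (hG.tendsto_groupFun t y))
  map_smul' c x := tendsto_nhds_unique (hG.tendsto_groupFun t (c • x)) (by
    simpa only [map_smul, RingHom.id_apply] using (hG.tendsto_groupFun t x).const_smul c)
  left_inv x := by rw [← groupFun_add, neg_add_cancel, groupFun_zero]
  right_inv x := by rw [← groupFun_add, add_neg_cancel, groupFun_zero]
  norm_map' := hG.norm_groupFun t

theorem unitaryGroup_apply (t : ℝ) (ψ : H) : hG.unitaryGroup t ψ = hG.groupFun t ψ := rfl

theorem norm_unitaryGroup_sub_self_le {a b : H} (hab : (a, b) ∈ G.graph) (t : ℝ) :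
    ‖hG.unitaryGroup t a - a‖ ≤ |t| * ‖b‖ :=
  le_of_tendsto_of_tendsto' ((hG.tendsto_groupFun t a).sub_const a).norm
    ((hG.tendsto_yosida hab).norm.const_mul |t|)
    fun k => norm_exp_smul_sub_self_le (hG.yosida_mem_skewAdjoint k) t a

theorem norm_unitaryGroup_sub_self_sub_le {a b z w : H} (hab : (a, b) ∈ G.graph)
    (hzw : (z, w) ∈ G.graph) (t : ℝ) :
    ‖hG.unitaryGroup t a - a - t • b‖ ≤ |t| * (2 * ‖b - z‖ + |t| * ‖w‖) :=
  le_of_tendsto_of_tendsto'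
    (((hG.tendsto_groupFun t a).sub_const a).sub ((hG.tendsto_yosida hab).const_smul t)).norm
    ((((((hG.tendsto_yosida hab).sub_const z).norm.const_mul 2).add
      ((hG.tendsto_yosida hzw).norm.const_mul |t|))).const_mul |t|)
    fun k => norm_exp_smul_sub_self_sub_le (hG.yosida_mem_skewAdjoint k) t a z

theorem hasDerivAt_unitaryGroup {a b : H} (hab : (a, b) ∈ G.graph) :
    HasDerivAt (fun t : ℝ => hG.unitaryGroup t a) b 0 := by
  rw [hasDerivAt_iff_isLittleO_nhds_zero, Asymptotics.isLittleO_iff]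
  intro ε hε
  obtain ⟨z, hz, hbz⟩ := Metric.mem_closure_iff.1 (hG.dense b) (ε / 4) (by positivity)
  obtain ⟨w, hzw⟩ := LinearPMap.mem_domain_iff.1 hz
  have h1 : Tendsto (fun t : ℝ => |t| * ‖w‖) (𝓝 0) (𝓝 0) := by
    have : Continuous fun t : ℝ => |t| * ‖w‖ := by fun_prop
    simpa using this.tendsto 0
  filter_upwards [h1.eventually_lt_const (show 0 < ε / 2 by positivity)] with t ht
  have h2 := hG.norm_unitaryGroup_sub_self_sub_le hab hzw t
  have h0 : hG.unitaryGroup 0 a = a := hG.groupFun_zero a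
  rw [dist_eq_norm] at hbz
  rw [zero_add, h0, Real.norm_eq_abs, mul_comm]
  refine h2.trans ?_
  gcongr
  linarith

/-- Existence in Stone's theorem. -/
theorem isUnitaryGroupOf_unitaryGroup : IsUnitaryGroupOf G hG.unitaryGroup where
  map_add s t := LinearIsometryEquiv.ext fun ψ => hG.groupFun_add s t ψ
  continuous ψ := by
    rw [Metric.continuous_iff]
    intro s ε hε
    obtain ⟨a, ha, haf⟩ := Metric.mem_closure_iff.1 (hG.dense ψ) (ε / 4) (by positivity)
    obtain ⟨b, hab⟩ := LinearPMap.mem_domain_iff.1 ha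
    refine ⟨ε / 4 / (‖b‖ + 1), by positivity, fun t ht => ?_⟩
    have h1 : hG.unitaryGroup t ψ = hG.unitaryGroup s (hG.unitaryGroup (t - s) ψ) := by
      rw [unitaryGroup_apply, unitaryGroup_apply, unitaryGroup_apply, ← groupFun_add,
        add_sub_cancel]
    rw [h1, LinearIsometryEquiv.dist_map, dist_eq_norm]
    have h2 := hG.norm_unitaryGroup_sub_self_le hab (t - s)
    have h3 : hG.unitaryGroup (t - s) ψ - ψ = hG.unitaryGroup (t - s) (ψ - a) +
        (hG.unitaryGroup (t - s) a - a) - (ψ - a) := by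
      rw [map_sub]; abel
    have h4 := norm_sub_le (hG.unitaryGroup (t - s) (ψ - a) +
        (hG.unitaryGroup (t - s) a - a)) (ψ - a)
    have h5 := norm_add_le (hG.unitaryGroup (t - s) (ψ - a)) (hG.unitaryGroup (t - s) a - a)
    rw [LinearIsometryEquiv.norm_map] at h5
    have h6 : |t - s| * ‖b‖ ≤ ε / 4 := by
      rw [Real.dist_eq, lt_div_iff₀ (by positivity)] at ht
      have : 0 ≤ |t - s| := abs_nonneg _
      nlinarith
    rw [dist_eq_norm] at haf
    rw [h3]
    linarith
  generator ψ v := by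
    refine ⟨hG.hasDerivAt_unitaryGroup, fun hv => ?_⟩
    rw [hG.mem_graph_iff]
    intro a b hab
    -- The pairing of two orbits is constant by unitarity; its derivative at 0 is the relation that
    -- puts (ψ, v) in the graph, by maximality of G.
    have h1 := (hG.hasDerivAt_unitaryGroup hab).inner ℂ hv
    simp only [LinearIsometryEquiv.inner_map_map] at h1
    have h2 := h1.unique (hasDerivAt_const (0 : ℝ) ⟪a, ψ⟫_ℂ)
    have h0 : ∀ x, hG.unitaryGroup 0 x = x := hG.groupFun_zero
    rw [h0, h0] at h2
    rw [add_comm]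
    exact h2

end IsSkewAdjoint

/-- By existence in Stone's theorem, the fallback branch of `expGroup` is not taken here. -/
theorem IsEssentiallySkewAdjoint.isUnitaryGroupOf_expGroup {S : H →ₗ.[ℂ] H}
    (hS : IsEssentiallySkewAdjoint S) : IsUnitaryGroupOf S.closure (expGroup S) := by
  have h : ∃ U : ℝ → H ≃ₗᵢ[ℂ] H, IsUnitaryGroupOf S.closure U :=
    ⟨_, hS.isSkewAdjoint_closure.isUnitaryGroupOf_unitaryGroup⟩
  have h1 : expGroup S = h.choose := funext fun t => by rw [expGroup, dif_pos h]
  rw [h1]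
  exact h.choose_spec

/-! ### Unitary groups along polygons -/

namespace IsUnitaryGroupOf

variable {S : H →ₗ.[ℂ] H} {U : ℝ → H ≃ₗᵢ[ℂ] H} (hU : IsUnitaryGroupOf S U)

include hU

theorem map_zero : U 0 = 1 := by
  simpa using hU.map_add 0 0

theorem map_zero_apply (ψ : H) : U 0 ψ = ψ := by
  rw [hU.map_zero]; rfl

theorem map_add_apply (s t : ℝ) (ψ : H) : U (s + t) ψ = U s (U t ψ) := by
  rw [hU.map_add]; rfl

theorem apply_mem_graph {x v : H} (h : (x, v) ∈ S.graph) (t : ℝ) :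
    (U t x, U t v) ∈ S.graph := by
  rw [hU.generator]
  have h1 := (((U t).toContinuousLinearEquiv : H →L[ℂ] H).restrictScalars
    ℝ).hasFDerivAt.comp_hasDerivAt (0 : ℝ) ((hU.generator x v).1 h)
  refine h1.congr_of_eventuallyEq (Eventually.of_forall fun s => ?_)
  change U s (U t x) = U t (U s x)
  rw [← hU.map_add_apply, ← hU.map_add_apply, add_comm]

theorem hasDerivAt {x v : H} (h : (x, v) ∈ S.graph) (t : ℝ) :
    HasDerivAt (fun s => U s x) (U t v) t := by
  have h1 := (hU.generator _ _).1 (hU.apply_mem_graph h t)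
  rw [← sub_self t] at h1
  refine (h1.comp_sub_const t t).congr_of_eventuallyEq (Eventually.of_forall fun s => ?_)
  change U s x = U (s - t) (U t x)
  rw [← hU.map_add_apply, sub_add_cancel]

/-- The error of one step along a straight segment in the domain of the generator. -/
theorem norm_apply_sub_le {y₀ y₁ z₀ z₁ : H} {σ C : ℝ} (h₀ : (y₀, z₀) ∈ S.graph)
    (h₁ : (y₁, z₁) ∈ S.graph) (hC₀ : ‖y₁ - y₀ - σ • z₀‖ ≤ C) (hC₁ : ‖y₁ - y₀ - σ • z₁‖ ≤ C) :
    ‖U σ y₀ - y₁‖ ≤ C := by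
  have hd : ∀ {x v : H}, (x, v) ∈ S.graph → ∀ r : ℝ,
      HasDerivAt (fun r : ℝ => U (-σ * r) x) ((-σ) • U (-σ * r) v) r := fun hx r => by
    have := (hU.hasDerivAt hx (-σ * r)).scomp r ((hasDerivAt_id r).const_mul (-σ))
    rw [mul_one] at this
    exact this
  have hreal : ∀ (c t : ℝ) (x : H), U t (c • x) = c • U t x := fun c t x => by
    rw [← Complex.coe_smul, map_smul, Complex.coe_smul]
  -- Pull the segment from y₀ to y₁ back by the group. The velocity is the image of the convex
  -- combination of the two endpoint errors, so both errors are assumed bounded.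
  have hg : ∀ r : ℝ, HasDerivAt (fun r : ℝ => U (-σ * r) y₀ + r • U (-σ * r) (y₁ - y₀))
      (U (-σ * r) ((1 - r) • (y₁ - y₀ - σ • z₀) + r • (y₁ - y₀ - σ • z₁))) r := fun r => by
    have := (hd h₀ r).add ((hasDerivAt_id r).smul (hd (S.graph.sub_mem h₁ h₀) r))
    refine this.congr_deriv ?_
    have e : (1 - r) • (y₁ - y₀ - σ • z₀) + r • (y₁ - y₀ - σ • z₁) =
        (y₁ - y₀) - σ • z₀ - (r * σ) • (z₁ - z₀) := by module
    have e' : U (-σ * r) (y₁ - y₀ - σ • z₀ - (r * σ) • (z₁ - z₀)) = U (-σ * r) y₁ - U (-σ * r) y₀ -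
        σ • U (-σ * r) z₀ - (r * σ) • (U (-σ * r) z₁ - U (-σ * r) z₀) := by
      simp only [map_sub, hreal]
    rw [e, e']
    simp only [map_sub, id]
    module
  have hb : ∀ r ∈ Set.Icc (0 : ℝ) 1,
      ‖U (-σ * r) ((1 - r) • (y₁ - y₀ - σ • z₀) + r • (y₁ - y₀ - σ • z₁))‖ ≤ C := fun r hr => by
    rw [LinearIsometryEquiv.norm_map]
    refine (norm_add_le _ _).trans ?_
    rw [norm_smul, norm_smul, Real.norm_of_nonneg hr.1, Real.norm_of_nonneg (sub_nonneg.2 hr.2)]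
    have h1 := mul_le_mul_of_nonneg_left hC₀ (sub_nonneg.2 hr.2)
    have h2 := mul_le_mul_of_nonneg_left hC₁ hr.1
    linarith
  have := (convex_Icc (0 : ℝ) 1).norm_image_sub_le_of_norm_hasDerivWithin_le
    (fun r _ => (hg r).hasDerivWithinAt) hb (x := 0) (y := 1) (by simp) (by simp)
  simp only [mul_one, mul_zero, zero_smul, one_smul, add_zero, sub_zero, norm_one, map_sub,
    add_sub_cancel, hU.map_zero_apply] at this
  have h1 : U σ (U (-σ) y₁ - y₀) = -(U σ y₀ - y₁) := by
    rw [map_sub, ← hU.map_add_apply, add_neg_cancel, hU.map_zero_apply]; abel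
  rwa [← (U σ).norm_map, h1, norm_neg] at this

/-- One-step errors only add up, because the group is isometric. -/
theorem norm_apply_nat_mul_sub_le {x z : ℕ → H} {σ C : ℝ} {N : ℕ}
    (h : ∀ n ≤ N, (x n, z n) ∈ S.graph)
    (hC : ∀ n < N, ‖x (n + 1) - x n - σ • z n‖ ≤ C)
    (hC' : ∀ n < N, ‖x (n + 1) - x n - σ • z (n + 1)‖ ≤ C) :
    ∀ n ≤ N, ‖U (n * σ) (x 0) - x n‖ ≤ n * C := by
  intro n
  induction n with
  | zero => simp [hU.map_zero_apply]
  | succ n ih =>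
    intro hn
    have h1 := ih (by omega)
    have h2 := hU.norm_apply_sub_le (h n (by omega)) (h (n + 1) hn) (hC n hn) (hC' n hn)
    have h3 : U ((n + 1 : ℕ) * σ) (x 0) - x (n + 1) =
        U σ (U (n * σ) (x 0) - x n) + (U σ (x n) - x (n + 1)) := by
      rw [map_sub, ← hU.map_add_apply]
      push_cast
      rw [show σ + n * σ = (n + 1) * σ by ring]
      abel
    have h4 := norm_add_le (U σ (U (n * σ) (x 0) - x n)) (U σ (x n) - x (n + 1))
    rw [LinearIsometryEquiv.norm_map] at h4
    rw [h3]
    push_cast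
    linarith

end IsUnitaryGroupOf

/-! ### Convergence of groups from convergence on a core -/

/-- For a fine enough subdivision, an orbit of a unitary group is nearly polygonal in the norm of
the graph of the generator. -/
theorem IsUnitaryGroupOf.exists_subdivision {G : H →ₗ.[ℂ] H} {V : ℝ → H ≃ₗᵢ[ℂ] H}
    (hV : IsUnitaryGroupOf G V) {ψ v : H} (h : (ψ, v) ∈ G.graph) (K : ℝ) {η : ℝ} (hη : 0 < η) :
    ∃ N : ℕ, 0 < N ∧ ‖V (K / N) ψ - ψ - (K / N) • v‖ ≤ η / N ∧ ‖V (K / N) v - v‖ ≤ η := by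
  have hK : Tendsto (fun N : ℕ => K / (N : ℝ)) atTop (𝓝 0) :=
    tendsto_const_div_atTop_nhds_zero_nat K
  have h1 := (hV.generator ψ v).1 h
  rw [hasDerivAt_iff_isLittleO_nhds_zero, Asymptotics.isLittleO_iff] at h1
  have h2 := hK.eventually (h1 (show 0 < η / (|K| + 1) by positivity))
  have h3 : Tendsto (fun t : ℝ => ‖V t v - v‖) (𝓝 0) (𝓝 0) := by
    have : Continuous fun t : ℝ => ‖V t v - v‖ := ((hV.continuous v).sub continuous_const).norm
    simpa [hV.map_zero_apply] using this.tendsto 0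
  obtain ⟨N, ⟨h4, h5⟩, hN⟩ :=
    ((h2.and (hK.eventually (h3.eventually_lt_const hη))).and (eventually_gt_atTop 0)).exists
  refine ⟨N, hN, ?_, h5.le⟩
  rw [zero_add, hV.map_zero_apply, norm_div, Real.norm_eq_abs, Real.norm_natCast] at h4
  refine h4.trans ?_
  rw [div_mul_div_comm, div_le_div_iff₀ (by positivity) (by positivity)]
  have : (0 : ℝ) < N := by exact_mod_cast hN
  nlinarith [mul_pos this hη]

/-- If the vectors `x` on which `τ S τ = τ a + K b` for fixed `a` and `b` form a core of `G`, with
`b = G x`, then `exp (τ S τ)` converges strongly to `exp (K G)` as `τ` tends to `0`. -/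
theorem tendsto_of_core {G : H →ₗ.[ℂ] H} {V : ℝ → H ≃ₗᵢ[ℂ] H} (hV : IsUnitaryGroupOf G V)
    (hd : Dense (G.domain : Set H)) {S : ℝ → H →ₗ.[ℂ] H} {U : ℝ → ℝ → H ≃ₗᵢ[ℂ] H}
    (hU : ∀ τ, IsUnitaryGroupOf (S τ) (U τ)) (K : ℝ)
    (hcore : ∀ x v : H, (x, v) ∈ G.graph → ∀ ε > 0, ∃ x' a b : H, ‖x' - x‖ ≤ ε ∧ ‖b - v‖ ≤ ε ∧
      ∀ τ, (x', a + (K / τ) • b) ∈ (S τ).graph) (ψ : H) :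
    Tendsto (fun τ => U τ τ ψ) (𝓝[>] 0) (𝓝 (V K ψ)) := by
  rw [Metric.tendsto_nhdsWithin_nhds]
  intro ε hε
  obtain ⟨ψ', hψ', hψψ'⟩ := Metric.mem_closure_iff.1 (hd ψ) (ε / 4) (by positivity)
  obtain ⟨v, hv⟩ := LinearPMap.mem_domain_iff.1 hψ'
  -- The polygon costs (4 + 2|K|)η and its two ends cost η each, which makes ε/4; replacing ψ by ψ'
  -- costs less than ε/4 twice.
  let η : ℝ := ε / 4 / (6 + 2 * |K|)
  have hη : 0 < η := by positivity
  obtain ⟨N, hN, hN1, hN2⟩ := hV.exists_subdivision hv K hη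
  have hN0 : (0 : ℝ) < N := by exact_mod_cast hN
  have hN1' : (1 : ℝ) ≤ N := by exact_mod_cast hN
  let y : ℕ → H := fun n => V (n * (K / N)) ψ'
  let w : ℕ → H := fun n => V (n * (K / N)) v
  have hy : ∀ n, ‖y (n + 1) - y n - (K / N) • w n‖ ≤ η / N := fun n => by
    have : y (n + 1) - y n - (K / N) • w n =
        V (n * (K / N)) (V (K / N) ψ' - ψ' - (K / N) • v) := by
      simp only [y, w]
      rw [map_sub, map_sub, ← hV.map_add_apply, ← Complex.coe_smul, ← Complex.coe_smul, map_smul]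
      push_cast
      rw [add_mul, one_mul]
    rw [this, LinearIsometryEquiv.norm_map]
    exact hN1
  have hw : ∀ n, ‖w (n + 1) - w n‖ ≤ η := fun n => by
    have : w (n + 1) - w n = V (n * (K / N)) (V (K / N) v - v) := by
      simp only [w]
      rw [map_sub, ← hV.map_add_apply]
      push_cast
      rw [add_mul, one_mul]
    rw [this, LinearIsometryEquiv.norm_map]
    exact hN2
  -- The vertices, and with them the vectors a n, are fixed before τ; hence τ may be taken small
  -- relative to the bound M on their norms.
  choose x a b hx hb hS using fun n : ℕ =>
    hcore (y n) (w n) (hV.apply_mem_graph hv _) (η / N) (by positivity)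
  have hηN : η / N ≤ η := div_le_self hη.le hN1'
  let M : ℝ := ∑ n ∈ Finset.range (N + 1), ‖a n‖
  have hM : 0 ≤ M := Finset.sum_nonneg fun _ _ => norm_nonneg _
  have haM : ∀ n ≤ N, ‖a n‖ ≤ M := fun n hn =>
    Finset.single_le_sum (f := fun n => ‖a n‖) (fun _ _ => norm_nonneg _)
      (Finset.mem_range.2 (by omega))
  refine ⟨η / (M + 1), by positivity, fun {τ} hτ hτ' => ?_⟩
  have hτ0 : (0 : ℝ) < τ := hτ
  rw [dist_zero_right, Real.norm_of_nonneg hτ0.le, lt_div_iff₀ (by positivity)] at hτ'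
  have haτ : ∀ n ≤ N, ‖(τ / N) • a n‖ ≤ η / N := fun n hn => by
    rw [norm_smul, Real.norm_of_nonneg (by positivity), div_mul_eq_mul_div]
    have := mul_le_mul_of_nonneg_left (haM n hn) hτ0.le
    gcongr
    nlinarith
  have hσ : ∀ n, (τ / N) • (a n + (K / τ) • b n) = (τ / N) • a n + (K / N) • b n := fun n => by
    rw [smul_add, smul_smul]
    congr 2
    field_simp
  have hKN : |K / N| = |K| / N := by rw [abs_div, abs_of_pos hN0]
  have hKη : ∀ {c : H}, ‖c‖ ≤ η → ‖(K / N) • c‖ ≤ |K| * (η / N) := fun hc => by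
    rw [norm_smul, Real.norm_eq_abs, hKN, div_mul_eq_mul_div, mul_div_assoc]
    gcongr
  -- In units of η/N, the 4 counts the step of the orbit, the two displaced vertices and the term in
  -- a; each |K| counts one error in the velocity, from b - w and, at the far endpoint, from the
  -- variation of w.
  have key := (hU τ).norm_apply_nat_mul_sub_le (x := x) (z := fun n => a n + (K / τ) • b n)
    (σ := τ / N) (C := (4 + 2 * |K|) * (η / N)) (N := N) (fun n _ => hS n τ)
    (fun n hn => by
      have : x (n + 1) - x n - (τ / N) • (a n + (K / τ) • b n) = (y (n + 1) - y n - (K / N) • w n)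
          + (x (n + 1) - y (n + 1)) - (x n - y n) - (K / N) • (b n - w n) - (τ / N) • a n := by
        rw [hσ, smul_sub]; abel
      rw [this]
      have h1 := hKη ((hb n).trans hηN)
      have h2 := haτ n hn.le
      refine (norm_sub_le _ _).trans ((add_le_add ((norm_sub_le _ _).trans (add_le_add
        ((norm_sub_le _ _).trans (add_le_add ((norm_add_le _ _).trans
          (add_le_add (hy n) (hx (n + 1)))) (hx n))) h1)) h2).trans ?_)
      have : 0 ≤ |K| * (η / N) := by positivity
      linarith)
    (fun n hn => by
      have : x (n + 1) - x n - (τ / N) • (a (n + 1) + (K / τ) • b (n + 1)) =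
          (y (n + 1) - y n - (K / N) • w n)
          + (x (n + 1) - y (n + 1)) - (x n - y n) - (K / N) • (b (n + 1) - w (n + 1))
          - (K / N) • (w (n + 1) - w n) - (τ / N) • a (n + 1) := by
        rw [hσ, smul_sub, smul_sub]; abel
      rw [this]
      have h1 := hKη ((hb (n + 1)).trans hηN)
      have h2 := haτ (n + 1) hn
      have h3 := hKη (hw n)
      refine (norm_sub_le _ _).trans ((add_le_add ((norm_sub_le _ _).trans (add_le_add
        ((norm_sub_le _ _).trans (add_le_add
        ((norm_sub_le _ _).trans (add_le_add ((norm_add_le _ _).trans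
          (add_le_add (hy n) (hx (n + 1)))) (hx n))) h1)) h3)) h2).trans ?_)
      linarith) N le_rfl
  rw [mul_div_cancel₀ _ hN0.ne'] at key
  have hy0 : y 0 = ψ' := by simp [y, hV.map_zero_apply]
  have hyN : y N = V K ψ' := by simp only [y]; rw [mul_div_cancel₀ _ hN0.ne']
  have h0 := (hx 0).trans hηN
  have hNN := (hx N).trans hηN
  rw [hy0] at h0
  rw [hyN] at hNN
  rw [dist_eq_norm] at hψψ' ⊢
  have hsplit : U τ τ ψ - V K ψ = U τ τ (ψ - ψ') - U τ τ (x 0 - ψ') + (U τ τ (x 0) - x N)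
      + (x N - V K ψ') - V K (ψ - ψ') := by
    simp only [map_sub]; abel
  have hη' : (6 + 2 * |K|) * η = ε / 4 := by
    simp only [η]; field_simp
  have hkey : (N : ℝ) * ((4 + 2 * |K|) * (η / N)) = (4 + 2 * |K|) * η := by field_simp
  rw [hkey] at key
  rw [hsplit]
  refine ((norm_sub_le _ _).trans (add_le_add ((norm_add_le _ _).trans (add_le_add
    ((norm_add_le _ _).trans (add_le_add (norm_sub_le _ _) key)) hNN)) le_rfl)).trans_lt ?_
  simp only [LinearIsometryEquiv.norm_map]
  linarith

/-! ### Diagonal operators and the commutator theorem -/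

section Diagonal

variable (φ : HilbertBasis ℕ ℂ H) {d : ℕ → ℝ}

theorem summable_sq_norm_inner (f : H) : Summable fun j => ‖⟪φ j, f⟫_ℂ‖ ^ 2 := by
  refine (φ.summable_inner_mul_inner f f).norm.congr fun j => ?_
  rw [norm_mul, norm_inner_symm, sq]

/-- The operator that is diagonal in the basis `φ` with coefficients `d j` in `[0, 1]`. -/
theorem exists_diagonal (hd0 : ∀ j, 0 ≤ d j) (hd1 : ∀ j, d j ≤ 1) :
    ∃ T : H →L[ℂ] H, ∀ f j, ⟪φ j, T f⟫_ℂ = d j * ⟪φ j, f⟫_ℂ := by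
  have hle : ∀ (f : H) j, ‖(d j : ℂ) * φ.repr f j‖ ≤ ‖φ.repr f j‖ := fun f j => by
    rw [norm_mul, Complex.norm_real, Real.norm_of_nonneg (hd0 j)]
    exact mul_le_of_le_one_left (norm_nonneg _) (hd1 j)
  have hmem : ∀ f : H, Memℓp (fun j => (d j : ℂ) * φ.repr f j) 2 := fun f =>
    (lp.memℓp (φ.repr f)).mono' (hle f)
  let L : H →ₗ[ℂ] H :=
    { toFun := fun f => φ.repr.symm ⟨_, hmem f⟩
      map_add' := fun f g => by
        rw [← map_add]
        congr 1
        ext j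
        exact (congrArg ((d j : ℂ) * ·) (congrArg (· j) (congrArg Subtype.val
          (map_add φ.repr f g)))).trans (mul_add _ _ _)
      map_smul' := fun c f => by
        rw [← map_smul]
        congr 1
        ext j
        simp [mul_left_comm] }
  have hL : ∀ f j, ⟪φ j, L f⟫_ℂ = d j * ⟪φ j, f⟫_ℂ := fun f j => by
    rw [← φ.repr_apply_apply, ← φ.repr_apply_apply]
    simp [L]
  refine ⟨L.mkContinuous 1 fun f => ?_, hL⟩
  rw [one_mul]
  have h1 := fun x : H => φ.hasSum_inner_mul_inner x x
  have h2 : ∀ x : H, HasSum (fun j => ‖⟪φ j, x⟫_ℂ‖ ^ 2) (‖x‖ ^ 2) := fun x => by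
    have := Complex.reCLM.hasSum (h1 x)
    convert this using 1
    · ext j
      rw [← inner_conj_symm, Complex.mul_conj, Complex.normSq_eq_norm_sq]
      simp [norm_inner_symm x, -Complex.ofReal_pow]
    · rw [inner_self_eq_norm_sq_to_K]
      simp [← Complex.ofReal_pow]
  refine le_of_sq_le_sq ?_ (norm_nonneg _)
  refine hasSum_le (fun j => ?_) (h2 (L f)) (h2 f)
  rw [hL]
  gcongr
  simpa only [φ.repr_apply_apply] using hle f j

end Diagonal

/-- Nelson's commutator theorem for a skew-adjoint `G` and a diagonal operator `|A|^k`: the span of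
the basis of eigenvectors is a core of `G`. -/
theorem IsSkewAdjoint.exists_mem_span_of_commutator_bound {G : H →ₗ.[ℂ] H}
    (hG : IsSkewAdjoint G) (φ : HilbertBasis ℕ ℂ H) (lam : ℕ → ℝ) (k c : ℝ)
    (hφ : ∀ j, φ j ∈ G.domain)
    (hc : ∀ ψ ∈ diagAbsPowDomain φ lam k, ∃ hB : ψ ∈ G.domain,
      |(⟪diagAbsPow φ lam k ψ, G ⟨ψ, hB⟩⟫_ℂ).re| ≤ c * ‖⟪diagAbsPow φ lam k ψ, ψ⟫_ℂ‖)
    {x v : H} (hxv : (x, v) ∈ G.graph) {ε : ℝ} (hε : 0 < ε) :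
    ∃ x' v' : H, x' ∈ Submodule.span ℂ (Set.range φ) ∧ (x', v') ∈ G.graph ∧
      ‖x' - x‖ ≤ ε ∧ ‖v' - v‖ ≤ ε := by
  let p : ℕ → ℝ := fun j => |lam j| ^ k
  have hp : ∀ j, 0 ≤ p j := fun j => Real.rpow_nonneg (abs_nonneg _) _
  -- T will be (1 + |A|^k)⁻¹: it maps H into D(|A|^k), and |A|^k T = 1 - T.
  let d : ℕ → ℝ := fun j => (1 + p j)⁻¹
  have hd0 : ∀ j, 0 < d j := fun j => inv_pos.2 (by have := hp j; linarith)
  have hd1 : ∀ j, d j ≤ 1 := fun j => inv_le_one_of_one_le₀ (by have := hp j; linarith)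
  have hpd : ∀ j, p j * d j = 1 - d j := fun j => by
    have : 1 + p j ≠ 0 := by have := hp j; positivity
    simp only [d]; field_simp; ring
  obtain ⟨T, hT⟩ := exists_diagonal φ (fun j => (hd0 j).le) hd1
  have hTmem : ∀ w, T w ∈ diagAbsPowDomain φ lam k := fun w => by
    refine Summable.of_nonneg_of_le (fun j => sq_nonneg _) (fun j => ?_)
      (summable_sq_norm_inner φ w)
    rw [hT, norm_mul, Complex.norm_real, Real.norm_of_nonneg (hd0 j).le, ← mul_assoc]
    change (p j * d j * _) ^ 2 ≤ _
    rw [hpd]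
    have h1 : 0 ≤ 1 - d j := sub_nonneg.2 (hd1 j)
    have h2 : 1 - d j ≤ 1 := by have := hd0 j; linarith
    gcongr
    exact mul_le_of_le_one_left (norm_nonneg _) h2
  have hPT : ∀ w, diagAbsPow φ lam k (T w) = w - T w := fun w => by
    refine HasSum.tsum_eq ?_
    refine ((φ.hasSum_repr w).sub (φ.hasSum_repr (T w))).congr_fun ?_
    intro j
    rw [φ.repr_apply_apply, φ.repr_apply_apply, hT, ← sub_smul, ← mul_assoc, ← Complex.ofReal_mul]
    change ((p j * d j : ℝ) * ⟪φ j, w⟫_ℂ) • φ j = _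
    rw [hpd]
    push_cast
    rw [sub_mul, one_mul]
  have hTdom : ∀ w, T w ∈ G.domain := fun w => (hc _ (hTmem w)).1
  let R : H →ₗ[ℂ] H := G.toFun.comp (T.toLinearMap.codRestrict G.domain hTdom)
  have hR : ∀ w, (T w, R w) ∈ G.graph := fun w => G.mem_graph ⟨T w, hTdom w⟩
  -- R = GT is everywhere defined with closed graph, so it is bounded.
  have hRcont : Continuous R := by
    refine R.continuous_of_isClosed_graph ?_
    have : (R.graph : Set (H × H)) =
        (fun q : H × H => (T q.1, q.2)) ⁻¹' (G.graph : Set (H × H)) := by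
      ext q
      simp only [SetLike.mem_coe, LinearMap.mem_graph_iff, Set.mem_preimage]
      refine ⟨fun h => h ▸ hR q.1, fun h => ?_⟩
      exact G.mem_graph_snd_inj h (hR q.1) rfl
    rw [this]
    exact hG.isClosed.preimage (by fun_prop)
  let l : ℝ := |c| + 1
  let M : Submodule ℂ H := (G.graph ⊓ (Submodule.span ℂ (Set.range φ)).comap
    (LinearMap.fst ℂ H H)).map ((l : ℂ) • LinearMap.fst ℂ H H - LinearMap.snd ℂ H H)
  -- It suffices that l - G has dense range on the span, since l - G controls the graph norm. If w
  -- is orthogonal to this range, testing on T φⱼ and extending by continuity gives l⟨w, Tw⟩ = ⟨w,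
  -- GTw⟩. The coupling inequality at Tw, where Re⟨Tw, GTw⟩ = 0, bounds this by |c|⟨w, Tw⟩. As l >
  -- |c|, ⟨w, Tw⟩ = 0, and w = 0 because all d j are positive.
  have hM : Mᗮ = ⊥ := by
    rw [Submodule.eq_bot_iff]
    intro w hw
    have hw1 : ∀ j, ⟪w, (l : ℂ) • φ j - G ⟨φ j, hφ j⟩⟫_ℂ = 0 := fun j => by
      refine Submodule.inner_left_of_mem_orthogonal ?_ hw
      exact ⟨(φ j, G ⟨φ j, hφ j⟩), ⟨G.mem_graph ⟨φ j, hφ j⟩, Submodule.subset_span ⟨j, rfl⟩⟩, rfl⟩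
    have hTφ : ∀ j, T (φ j) = (d j : ℂ) • φ j := fun j => by
      refine φ.repr.injective (lp.ext (funext fun i => ?_))
      rw [φ.repr_apply_apply, φ.repr_apply_apply, hT, inner_smul_right]
      by_cases hij : i = j
      · rw [hij]
      · rw [φ.orthonormal.2 hij, mul_zero, mul_zero]
    let RC : H →L[ℂ] H := ⟨R, hRcont⟩
    have hfun : (innerSL ℂ w).comp ((l : ℂ) • T - RC) = 0 := by
      refine ContinuousLinearMap.ext_on (s := Set.range φ) ?_ ?_
      · rw [dense_iff_closure_eq, ← Submodule.topologicalClosure_coe, φ.dense_span]; rfl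
      · rintro _ ⟨j, rfl⟩
        have h1 := hR (φ j)
        rw [hTφ] at h1
        have h2 : R (φ j) = (d j : ℂ) • G ⟨φ j, hφ j⟩ :=
          G.mem_graph_snd_inj h1 (G.graph.smul_mem (d j : ℂ) (G.mem_graph ⟨φ j, hφ j⟩)) rfl
        change ⟪w, (l : ℂ) • T (φ j) - R (φ j)⟫_ℂ = 0
        rw [h2, hTφ, smul_comm, ← smul_sub, inner_smul_right, hw1, mul_zero]
    have hfw : ⟪w, (l : ℂ) • T w - R w⟫_ℂ = 0 := congrArg (fun F : H →L[ℂ] ℂ => F w) hfun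
    rw [inner_sub_right, inner_smul_right, sub_eq_zero] at hfw
    have hsum : HasSum (fun j => ((d j * ‖⟪φ j, w⟫_ℂ‖ ^ 2 : ℝ) : ℂ)) ⟪w, T w⟫_ℂ := by
      refine (φ.hasSum_inner_mul_inner w (T w)).congr_fun fun j => ?_
      rw [hT, ← inner_conj_symm w (φ j), mul_left_comm, ← Complex.normSq_eq_conj_mul_self,
        Complex.normSq_eq_norm_sq, Complex.ofReal_mul]
    have hsum_re : HasSum (fun j => d j * ‖⟪φ j, w⟫_ℂ‖ ^ 2) (⟪w, T w⟫_ℂ).re :=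
      Complex.hasSum_re hsum
    have hnorm : ‖⟪w - T w, T w⟫_ℂ‖ ≤ (⟪w, T w⟫_ℂ).re := by
      refine HasSum.norm_le_of_bounded (φ.hasSum_inner_mul_inner (w - T w) (T w)) hsum_re
        fun j => ?_
      have h1 : 0 ≤ 1 - d j := sub_nonneg.2 (hd1 j)
      have h2 : ‖⟪w - T w, φ j⟫_ℂ‖ = (1 - d j) * ‖⟪φ j, w⟫_ℂ‖ := by
        rw [norm_inner_symm, inner_sub_right, hT, ← one_sub_mul, norm_mul, ← Complex.ofReal_one,
          ← Complex.ofReal_sub, Complex.norm_real, Real.norm_of_nonneg h1]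
      rw [norm_mul, h2, hT, norm_mul, Complex.norm_real, Real.norm_of_nonneg (hd0 j).le]
      have h3 : 0 ≤ d j * ‖⟪φ j, w⟫_ℂ‖ ^ 2 := mul_nonneg (hd0 j).le (sq_nonneg _)
      have := hd0 j
      nlinarith
    obtain ⟨hB, hbound⟩ := hc _ (hTmem w)
    have hq0 : 0 ≤ (⟪w, T w⟫_ℂ).re := (norm_nonneg _).trans hnorm
    have hGT : G ⟨T w, hB⟩ = R w := rfl
    rw [hPT, hGT, inner_sub_left, Complex.sub_re, hG.re_inner_eq_zero (hR w), sub_zero, ← hfw,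
      Complex.re_ofReal_mul] at hbound
    have hle : l * (⟪w, T w⟫_ℂ).re ≤ |c| * (⟪w, T w⟫_ℂ).re := by
      refine (le_abs_self _).trans (hbound.trans ?_)
      exact (mul_le_mul_of_nonneg_right (le_abs_self c) (norm_nonneg _)).trans
        (mul_le_mul_of_nonneg_left hnorm (abs_nonneg c))
    have hq : (⟪w, T w⟫_ℂ).re = 0 := by simp only [l] at hle; linarith
    rw [hq] at hsum_re
    have hz := (hasSum_zero_iff_of_nonneg fun j => mul_nonneg (hd0 j).le (sq_nonneg _)).1 hsum_re
    refine φ.repr.injective (lp.ext (funext fun j => ?_))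
    have := congrFun hz j
    simp only [Pi.zero_apply, mul_eq_zero, (hd0 j).ne', false_or] at this
    rw [φ.repr_apply_apply, φ.repr_apply_apply, inner_zero_right]
    simpa using this
  have hMd : Dense (M : Set H) := Submodule.dense_iff_topologicalClosure_eq_top.2
    (Submodule.topologicalClosure_eq_top_iff.2 hM)
  obtain ⟨f, hf, hfd⟩ := Metric.mem_closure_iff.1 (hMd ((l : ℂ) • x - v)) ε hε
  obtain ⟨⟨x', v'⟩, ⟨hgr, hspan⟩, rfl⟩ := hf
  refine ⟨x', v', hspan, hgr, ?_, ?_⟩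
  all_goals
    have hs := G.graph.sub_mem hgr hxv
    have h1 := hG.norm_le_of_mem_graph (x := x' - x) (y := v' - v) hs l
    have h2 := hG.abs_mul_norm_le_of_mem_graph (x := x' - x) (y := v' - v) hs l
    have h3 : (l : ℂ) • (x' - x) - (v' - v) = ((l : ℂ) • x' - v') - ((l : ℂ) • x - v) := by module
    rw [dist_comm, dist_eq_norm] at hfd
    change ‖((l : ℂ) • x' - v') - ((l : ℂ) • x - v)‖ < ε at hfd
    rw [h3] at h1 h2
  -- The choice l = |c| + 1 also ensures l ≥ 1, so the error in x needs no further constant.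
  · have h4 : 1 * ‖x' - x‖ ≤ |l| * ‖x' - x‖ := by
      gcongr
      exact (le_add_of_nonneg_left (abs_nonneg c)).trans (le_abs_self l)
    linarith
  · linarith

/-! ### Large controls during short times -/

theorem mem_graph_closure_controlled {A B : H →ₗ.[ℂ] H} {x : H} (hA : x ∈ A.domain)
    (hB : x ∈ B.domain) (u : ℝ) :
    (x, A ⟨x, hA⟩ + u • B ⟨x, hB⟩) ∈ (controlled A B u).closure.graph := by
  refine LinearPMap.le_graph_of_le (controlled A B u).le_closure ?_
  have hx : x ∈ (controlled A B u).domain := ⟨hA, hB⟩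
  have h := (controlled A B u).mem_graph ⟨x, hx⟩
  rw [← Complex.coe_smul]
  exact h

/-- Controls with constant value `K / τ` during the time `τ` approximate `exp (K B)`. -/
theorem IsWeaklyCoupled.tendsto_expGroup_controlled {k : ℝ} {A B : H →ₗ.[ℂ] H}
    (hAB : IsWeaklyCoupled k A B) (K : ℝ) (ψ : H) :
    Tendsto (fun τ : ℝ => expGroup (controlled A B (K / τ)) τ ψ) (𝓝[>] 0)
      (𝓝 (expGroup B K ψ)) := by
  obtain ⟨φ, lam, hst, -, -, c, hc⟩ := hAB
  have hB := hst.skew_B.isSkewAdjoint_closure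
  refine tendsto_of_core hst.skew_B.isUnitaryGroupOf_expGroup hB.dense
    (S := fun τ => (controlled A B (K / τ)).closure)
    (U := fun τ => expGroup (controlled A B (K / τ)))
    (fun τ => (hst.skew_controlled _).isUnitaryGroupOf_expGroup) K (fun x v hxv ε hε => ?_) ψ
  obtain ⟨x', v', hspan, hgr, hx, hv⟩ := hB.exists_mem_span_of_commutator_bound φ lam k c
    (fun j => B.le_closure.1 (hst.mem_B j)) hc hxv hε
  have hle : Submodule.span ℂ (Set.range φ) ≤ A.domain ⊓ B.domain := by
    rw [Submodule.span_le]
    rintro _ ⟨j, rfl⟩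
    exact ⟨(hst.eigen j).1, hst.mem_B j⟩
  obtain ⟨hxA, hxB⟩ := hle hspan
  refine ⟨x', A ⟨x', hxA⟩, B ⟨x', hxB⟩, hx, ?_, fun τ => mem_graph_closure_controlled hxA hxB _⟩
  -- The core vector lies in D(B) itself, so its image under the closure is its image under B.
  have : B ⟨x', hxB⟩ = v' := B.closure.mem_graph_snd_inj
    (LinearPMap.le_graph_of_le B.le_closure (B.mem_graph ⟨x', hxB⟩)) hgr rfl
  rwa [this]

theorem expGroup_controlled_mem_reachableSetLT (A B : H →ₗ.[ℂ] H) (u : ℝ) {τ T : ℝ} (hτ : 0 ≤ τ)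
    (hT : τ < T) (ψ : H) : expGroup (controlled A B u) τ ψ ∈ reachableSetLT A B T ψ :=
  ⟨τ, hτ, hT, [(u, τ)], by simpa using hτ, by simp, rfl⟩

end BilinearQuantum

end

theorem mainTheorem3 {H : Type*} [NormedAddCommGroup H] [InnerProductSpace ℂ H] [CompleteSpace H]
    (A B : H →ₗ.[ℂ] H) (k : ℝ) (hk : 0 < k) (hAB : BilinearQuantum.IsWeaklyCoupled k A B)
    (ψ₀ : H) (hψ₀ : ψ₀ ∈ Metric.sphere (0 : H) 1) (T : ℝ) (hT : 0 < T) :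
    {ψ | ∃ K : ℝ, ψ = BilinearQuantum.expGroup B K ψ₀} ⊆
      closure (BilinearQuantum.reachableSetLT A B T ψ₀) := by
  rintro _ ⟨K, rfl⟩
  refine mem_closure_of_tendsto (hAB.tendsto_expGroup_controlled K ψ₀) ?_
  filter_upwards [Ioo_mem_nhdsGT hT] with τ hτ
  exact BilinearQuantum.expGroup_controlled_mem_reachableSetLT A B _ hτ.1.le hτ.2 ψ₀
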